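/- Let $T,d\in\mathbb{N}$ and $\mathcal{X}=(\mathbb{R}^d)^T$ with coordinates $x=(x_{t,i})_{1\le t\le T,\,1\le i\le d}$; write $X_t(x)=x_t\in\mathbb{R}^d$ and $X_{t,i}(x)=x_{t,i}$. Let $\mathcal{P}(E)$ denote the Borel probability measures on $E$ with finite first moment, and let $\mathcal{W}_1$ be the Wasserstein distance of order $1$ on $\mathcal{P}(\mathbb{R})$. For $\check\mu=(\mu_{t,i})_{1\le t\le T,\,1\le i\le d}\in\mathcal{P}(\mathbb{R})^{dT}$ let $\Pi(\check\mu)$ be the set of $\pi\in\mathcal{P}(\mathcal{X})$ with $\pi\circ X_{t,i}^{-1}=\mu_{t,i}$ for all $t,i$; let $\mathcal{M}(\check\mu)$ be the set of $\pi\in\Pi(\check\mu)$ with $\mathbb{E}_\pi[X_{t+1}\mid X_1,\dots,X_t]=X_t$ for $1\le t\le T-1$; and for $\varepsilon\ge 0$ let $\mathcal{M}_\varepsilon(\check\mu)$ be the set of $\pi\in\Pi(\check\mu)$ with $$\mathbb{E}_\pi\Big[\big|\mathbb{E}_\pi[X_{t+1}\mid X_1,\dots,X_t]-X_t\big|\Big]\le\varepsilon,\qquad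 1\le t\le T-1,$$ where $|\cdot|$ is the $\ell_1$ norm. For $c:\mathcal{X}\to\mathbb{R}$ let $\overline{\mathsf P}(\check\mu)$ and $\underline{\mathsf P}(\check\mu)$ be the supremum and the infimum of $\int c\,d\pi$ over $\pi\in\mathcal{M}(\check\mu)$, and let $\overline{\mathsf P}_\varepsilon(\check\mu)$ and $\underline{\mathsf P}_\varepsilon(\check\mu)$ be the supremum and the infimum of $\int c\,d\pi$ over $\pi\in\mathcal{M}_\varepsilon(\check\mu)$. An optimizer is an element of the constraint set at which the supremum (respectively infimum) is attained. **Theorem.** Let $\check\mu\in\mathcal{P}(\mathbb{R})^{dT}$ satisfy $\mathcal{M}(\check\mu)\ne\emptyset$, and let $\check\mu^n=(\mu^n_{t,i})\in\mathcal{P}(\mathbb{R})^{dT}$, $n\ge1$, satisfy $\lim_{n\to\infty}r_n=0$, where $r_n:=2\max_{1\le t\le T}\sum_{i=1}^d\mathcal{W}_1(\mu^n_{t,i},\mu_{t,i})$. Then $\mathcal{M}_{r_n}(\check\mu^n)\ne\emptyset$ for all $n\ge1$. If, further, $c$ is Lipschitz and $(\varepsilon_n)_{n\ge1}$ is any sequence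 converging to zero with $\varepsilon_n\ge r_n$ for all $n\ge1$, then the following hold. (i) The values $\overline{\mathsf P}(\check\mu)$ and $\underline{\mathsf P}(\check\mu)$ are finite, and $\lim_{n\to\infty}\overline{\mathsf P}_{\varepsilon_n}(\check\mu^n)=\overline{\mathsf P}(\check\mu)$ and $\lim_{n\to\infty}\underline{\mathsf P}_{\varepsilon_n}(\check\mu^n)=\underline{\mathsf P}(\check\mu)$. (ii) For each $n\ge1$, $\overline{\mathsf P}_{\varepsilon_n}(\check\mu^n)$ (resp. $\underline{\mathsf P}_{\varepsilon_n}(\check\mu^n)$) admits an optimizer. For every choice of such optimizers $\pi_n$, the sequence $(\pi_n)_{n\ge1}$ is tight, and every limit point of it in the weak topology is an optimizer for $\overline{\mathsf P}(\check\mu)$ (resp. $\underline{\mathsf P}(\check\mu)$). In particular, if $\overline{\mathsf P}(\check\mu)$ (resp. $\underline{\mathsf P}(\check\mu)$) has a unique optimizer, then $(\pi_n)_{n\ge1}$ converges weakly to it. -/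

import Mathlib

open MeasureTheory Filter Topology
open scoped ENNReal

namespace MMOT

noncomputable section

/-- The path space `(ℝ^d)^T`; `x t i` is the `i`-th coordinate at time `t`. The times
`1, …, T` of the text are the elements `0, …, T - 1` of `Fin T`. -/
abbrev PathSpace (T d : ℕ) : Type := Fin T → Fin d → ℝ

/-- A family of probability measures on the line, one for each time and coordinate. -/
abbrev Marginals (T d : ℕ) : Type := Fin T → Fin d → ProbabilityMeasure ℝ

/-- All the marginals have a finite first moment. -/
def Marginals.FiniteFirstMoments {T d : ℕ} (μ : Marginals T d) : Prop :=
  ∀ t i, Integrable (fun y : ℝ => y) (μ t i : Measure ℝ)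

/-- Couplings: probability measures on the plane with marginals `μ` and `ν`. -/
def couplings (μ ν : ProbabilityMeasure ℝ) : Set (ProbabilityMeasure (ℝ × ℝ)) :=
  {γ | (γ : Measure (ℝ × ℝ)).map Prod.fst = μ ∧ (γ : Measure (ℝ × ℝ)).map Prod.snd = ν}

/-- The Wasserstein distance of order one, with values in `[0, ∞]`. -/
def wasserstein (μ ν : ProbabilityMeasure ℝ) : ℝ≥0∞ :=
  ⨅ γ ∈ couplings μ ν, ∫⁻ p, ENNReal.ofReal |p.1 - p.2| ∂(γ : Measure (ℝ × ℝ))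

/-- `2 max_t ∑_i W₁(ν_{t,i}, μ_{t,i})`. The Wasserstein distances are finite for measures with
finite first moments. -/
def discrepancy {T d : ℕ} (ν μ : Marginals T d) : ℝ :=
  2 * ⨆ t, ∑ i, (wasserstein (ν t i) (μ t i)).toReal

/-- The laws on path space with a finite first moment and one-dimensional marginals `μ`. -/
def transportPlans {T d : ℕ} (μ : Marginals T d) : Set (ProbabilityMeasure (PathSpace T d)) :=
  {π | Integrable (fun x => x) (π : Measure (PathSpace T d)) ∧
    ∀ t i, (π : Measure (PathSpace T d)).map (fun x => x t i) = μ t i}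

/-- The `i`-th coordinate of `E_π[X_t | X_1, …, X_s]`. -/
def condMean {T d : ℕ} (π : ProbabilityMeasure (PathSpace T d)) (s t : Fin T) (i : Fin d) :
    PathSpace T d → ℝ :=
  (π : Measure (PathSpace T d))[fun x => x t i |
    Filtration.piLE (X := fun _ : Fin T => Fin d → ℝ) s]

/-- The transport plans under which the coordinate process is a martingale. -/
def martingalePlans {T d : ℕ} (μ : Marginals T d) : Set (ProbabilityMeasure (PathSpace T d)) :=
  {π | π ∈ transportPlans μ ∧ ∀ s t : Fin T, (s : ℕ) + 1 = (t : ℕ) →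
    ∀ i, condMean π s t i =ᵐ[(π : Measure (PathSpace T d))] fun x => x s i}

/-- The transport plans for which each expected `ℓ¹`-deviation from the martingale property
is at most `ε`. -/
def relaxedPlans {T d : ℕ} (ε : ℝ) (μ : Marginals T d) :
    Set (ProbabilityMeasure (PathSpace T d)) :=
  {π | π ∈ transportPlans μ ∧ ∀ s t : Fin T, (s : ℕ) + 1 = (t : ℕ) →
    ∫ x, ∑ i, |condMean π s t i x - x s i| ∂(π : Measure (PathSpace T d)) ≤ ε}

/-- The supremum of `∫ c dπ` over `π ∈ S`, in the extended reals. -/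
def upperValue {T d : ℕ} (c : PathSpace T d → ℝ)
    (S : Set (ProbabilityMeasure (PathSpace T d))) : EReal :=
  ⨆ π ∈ S, ((∫ x, c x ∂(π : Measure (PathSpace T d)) : ℝ) : EReal)

/-- The infimum of `∫ c dπ` over `π ∈ S`, in the extended reals. -/
def lowerValue {T d : ℕ} (c : PathSpace T d → ℝ)
    (S : Set (ProbabilityMeasure (PathSpace T d))) : EReal :=
  ⨅ π ∈ S, ((∫ x, c x ∂(π : Measure (PathSpace T d)) : ℝ) : EReal)

/-- `π` attains the supremum of `∫ c dπ` over `S`. -/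
def IsMaximizer {T d : ℕ} (c : PathSpace T d → ℝ)
    (S : Set (ProbabilityMeasure (PathSpace T d))) (π : ProbabilityMeasure (PathSpace T d)) :
    Prop :=
  π ∈ S ∧ ((∫ x, c x ∂(π : Measure (PathSpace T d)) : ℝ) : EReal) = upperValue c S

/-- `π` attains the infimum of `∫ c dπ` over `S`. -/
def IsMinimizer {T d : ℕ} (c : PathSpace T d → ℝ)
    (S : Set (ProbabilityMeasure (PathSpace T d))) (π : ProbabilityMeasure (PathSpace T d)) :
    Prop :=
  π ∈ S ∧ ((∫ x, c x ∂(π : Measure (PathSpace T d)) : ℝ) : EReal) = lowerValue c S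

end

end MMOT

/-! The theorem combines an approximation result with a closedness result; compactness does the
rest.

Approximation (`exists_relaxedPlan`). Let `X` be a martingale with marginals `μ`, and couple each `ν
t i` with `μ t i`. Every coupling can be realized as `Y t i = f t i (X t i) U`, with `U` uniform and
independent of `X`. By independence, `X` is still a martingale when `U` is revealed at the start,
and the past of `Y` is a function of `U` and the past of `X`. Tested against a function of the past
of `Y` bounded by one, the increment `Y t - Y s` therefore contributes at most the transport costs
at times `t` and `s`; this is the factor 2 in `discrepancy`. Since `Y` is close to `X` in `L¹`,
integrals of Lipschitz functions change little. A limit along nearly optimal couplings yields the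
exact bound.

Closedness (`mem_relaxedPlans_of_tendsto`). A conditional expectation is not weakly continuous in
the law, but its `L¹` norm is a supremum of integrals of `φ(past) * (X t - X s)` over continuous `φ`
bounded by one (`integral_sum_abs_condMean_sub_le_iff`). These integrands have linear growth, and
first absolute moments are determined by the marginals and converge, so the integrals pass to weak
limits. With `ε n → 0` the limit is a martingale plan.

Bounded first moments give tightness. Any limit of relaxed maximizers is thus a martingale plan, and
it beats every martingale plan because the latter has relaxed approximants as competitors.
Minimization is maximization of `-c`. -/

namespace MMOT

/-! ### Weak convergence and integrals of unbounded functions -/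

section WeakConvergence

variable {Ω ι : Type*} [TopologicalSpace Ω] [MeasurableSpace Ω] [OpensMeasurableSpace Ω]
  {F : Filter ι} {π : ι → ProbabilityMeasure Ω} {ρ : ProbabilityMeasure Ω}

lemma tendsto_integral_of_bounded (hπ : Tendsto π F (𝓝 ρ)) {f : Ω → ℝ} (hf : Continuous f)
    {C : ℝ} (hC : ∀ x, |f x| ≤ C) :
    Tendsto (fun n => ∫ x, f x ∂(π n : Measure Ω)) F (𝓝 (∫ x, f x ∂(ρ : Measure Ω))) :=
  ProbabilityMeasure.tendsto_iff_forall_integral_tendsto.1 hπ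
    (BoundedContinuousFunction.ofNormedAddCommGroup f hf C hC)

/-- Fatou's lemma for weak convergence. -/
lemma eventually_lt_integral (hπ : Tendsto π F (𝓝 ρ)) {h : Ω → ℝ} (hc : Continuous h)
    (h0 : ∀ x, 0 ≤ h x) (hρ : Integrable h (ρ : Measure Ω))
    (hi : ∀ n, Integrable h (π n : Measure Ω)) {a : ℝ} (ha : a < ∫ x, h x ∂(ρ : Measure Ω)) :
    ∀ᶠ n in F, a < ∫ x, h x ∂(π n : Measure Ω) := by
  have hlim : Tendsto (fun M : ℕ => ∫ x, min (h x) M ∂(ρ : Measure Ω)) atTop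
      (𝓝 (∫ x, h x ∂(ρ : Measure Ω))) := by
    refine tendsto_integral_of_dominated_convergence h
      (fun M => (hc.min continuous_const).measurable.aestronglyMeasurable) hρ ?_ ?_
    · intro M
      filter_upwards with x
      rw [Real.norm_eq_abs, abs_of_nonneg (le_min (h0 x) (Nat.cast_nonneg M))]
      exact min_le_left _ _
    · filter_upwards with x
      refine tendsto_const_nhds.congr' ?_
      obtain ⟨M, hM⟩ := exists_nat_ge (h x)
      filter_upwards [eventually_ge_atTop M] with k hk
      exact (min_eq_left (hM.trans (by exact_mod_cast hk))).symm
  obtain ⟨M, hM⟩ := (hlim.eventually (lt_mem_nhds ha)).exists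
  have hb : ∀ x, |min (h x) (M : ℝ)| ≤ M := fun x => by
    rw [abs_of_nonneg (le_min (h0 x) (Nat.cast_nonneg M))]
    exact min_le_right _ _
  have hcM : Continuous fun x => min (h x) (M : ℝ) := hc.min continuous_const
  -- The truncation at `M` is bounded and continuous, so weak convergence applies to it, and it lies
  -- below `h`.
  filter_upwards [(tendsto_integral_of_bounded hπ hcM hb).eventually (lt_mem_nhds hM)] with n hn
  refine hn.trans_le (integral_mono_ae ?_ (hi n) (ae_of_all _ fun x => min_le_left _ _))
  exact (hi n).mono' hcM.measurable.aestronglyMeasurable (ae_of_all _ fun x => by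
    rw [Real.norm_eq_abs, abs_of_nonneg (le_min (h0 x) (Nat.cast_nonneg M))]
    exact min_le_left _ _)

/-- Fatou applies to `G + f ≥ 0`; convergence of the integrals of `G` then allows `G` to be
subtracted again. -/
lemma eventually_lt_integral_of_dominated (hπ : Tendsto π F (𝓝 ρ)) {f G : Ω → ℝ}
    (hf : Continuous f) (hG : Continuous G) (hfG : ∀ x, |f x| ≤ G x)
    (hρ : Integrable G (ρ : Measure Ω)) (hi : ∀ n, Integrable G (π n : Measure Ω))
    (hlim : Tendsto (fun n => ∫ x, G x ∂(π n : Measure Ω)) F (𝓝 (∫ x, G x ∂(ρ : Measure Ω))))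
    {a : ℝ} (ha : a < ∫ x, f x ∂(ρ : Measure Ω)) :
    ∀ᶠ n in F, a < ∫ x, f x ∂(π n : Measure Ω) := by
  have hfi : ∀ {κ : Measure Ω}, Integrable G κ → Integrable f κ := fun h =>
    h.mono' hf.measurable.aestronglyMeasurable (ae_of_all _ hfG)
  set b := ∫ x, G x ∂(ρ : Measure Ω)
  set δ := (∫ x, f x ∂(ρ : Measure Ω)) - a
  -- The integral of `G + f` under `ρ` is `b + a + δ`. Half of the margin `δ` is spent here, the
  -- other half on the integrals of `G`.
  have h1 := eventually_lt_integral hπ (h := fun x => G x + f x) (hG.add hf)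
    (fun x => by linarith [neg_le_of_abs_le (hfG x)]) (hρ.add (hfi hρ))
    (fun n => (hi n).add (hfi (hi n))) (a := b + a + δ / 2) (by
      rw [integral_add hρ (hfi hρ)]
      linarith)
  filter_upwards [h1, hlim.eventually (gt_mem_nhds (show b < b + δ / 2 by linarith))] with n h1 h2
  rw [integral_add (hi n) (hfi (hi n))] at h1
  linarith

/-- Dominated convergence for weak convergence. -/
lemma tendsto_integral_of_dominated (hπ : Tendsto π F (𝓝 ρ)) {f G : Ω → ℝ}
    (hf : Continuous f) (hG : Continuous G) (hfG : ∀ x, |f x| ≤ G x)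
    (hρ : Integrable G (ρ : Measure Ω)) (hi : ∀ n, Integrable G (π n : Measure Ω))
    (hlim : Tendsto (fun n => ∫ x, G x ∂(π n : Measure Ω)) F (𝓝 (∫ x, G x ∂(ρ : Measure Ω)))) :
    Tendsto (fun n => ∫ x, f x ∂(π n : Measure Ω)) F (𝓝 (∫ x, f x ∂(ρ : Measure Ω))) := by
  refine tendsto_order.2 ⟨fun a ha =>
    eventually_lt_integral_of_dominated hπ hf hG hfG hρ hi hlim ha, fun a ha => ?_⟩
  have := eventually_lt_integral_of_dominated hπ hf.neg hG (fun x => by simpa using hfG x)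
    hρ hi hlim (a := -a) (by simpa [integral_neg] using ha)
  simpa [integral_neg] using this

end WeakConvergence

/-! ### The `L¹` norm of a conditional expectation by duality -/

section CondExp

variable {Ω S : Type*} {m₀ : MeasurableSpace Ω} {μ : Measure Ω} [IsProbabilityMeasure μ]

lemma integral_mul_condExp {m : MeasurableSpace Ω} (hm : m ≤ m₀) {f h : Ω → ℝ}
    (hf : Integrable f μ) (hh : StronglyMeasurable[m] h) {C : ℝ} (hC : ∀ x, |h x| ≤ C) :
    ∫ x, h x * f x ∂μ = ∫ x, h x * (μ[f | m]) x ∂μ := by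
  have h1 := condExp_stronglyMeasurable_mul_of_bound hm hh hf C (ae_of_all _ hC)
  exact (integral_condExp hm).symm.trans (integral_congr_ae h1)

lemma integral_mul_le_integral_abs_condExp {m : MeasurableSpace Ω} (hm : m ≤ m₀) {f h : Ω → ℝ}
    (hf : Integrable f μ) (hh : StronglyMeasurable[m] h) (hC : ∀ x, |h x| ≤ 1) :
    ∫ x, h x * f x ∂μ ≤ ∫ x, |(μ[f | m]) x| ∂μ := by
  rw [integral_mul_condExp hm hf hh hC]
  refine integral_mono (integrable_condExp.bdd_mul (hh.mono hm).aestronglyMeasurable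
    (ae_of_all _ hC)) integrable_condExp.abs fun x => ?_
  calc h x * (μ[f | m]) x ≤ |h x * (μ[f | m]) x| := le_abs_self _
    _ = |h x| * |(μ[f | m]) x| := abs_mul _ _
    _ ≤ _ := mul_le_of_le_one_left (abs_nonneg _) (hC x)

/-- The `L¹` norm of a conditional expectation is nearly attained by continuous test functions. -/
lemma exists_integral_abs_condExp_le [MeasurableSpace S] [TopologicalSpace S]
    [TopologicalSpace.PseudoMetrizableSpace S] [BorelSpace S] {r : Ω → S} (hr : Measurable r)
    {f : Ω → ℝ} (hf : Integrable f μ) {δ : ℝ} (hδ : 0 < δ) :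
    ∃ φ : S → ℝ, Continuous φ ∧ (∀ y, |φ y| ≤ 1) ∧
      ∫ x, |(μ[f | MeasurableSpace.comap r inferInstance]) x| ∂μ
        ≤ ∫ x, φ (r x) * f x ∂μ + δ := by
  have hm : MeasurableSpace.comap r inferInstance ≤ m₀ := hr.comap_le
  set Y := μ[f | MeasurableSpace.comap r inferInstance]
  have hYm : StronglyMeasurable[MeasurableSpace.comap r inferInstance] Y :=
    stronglyMeasurable_condExp
  -- Doob–Dynkin: `Y = y ∘ r`, so `y` can be approximated in `L¹` of the law of `r` by a bounded
  -- continuous `g`.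
  obtain ⟨y, hy, hYy⟩ := hYm.measurable.exists_eq_measurable_comp
  have hyi : Integrable y (μ.map r) := by
    rw [integrable_map_measure hy.aestronglyMeasurable hr.aemeasurable, ← hYy]
    exact integrable_condExp
  have : IsProbabilityMeasure (μ.map r) := Measure.isProbabilityMeasure_map hr.aemeasurable
  obtain ⟨g, hg, hgi⟩ := hyi.exists_boundedContinuous_integral_sub_le
    (show (0 : ℝ) < δ / 4 by positivity)
  -- A continuous substitute for the sign of `g`: linear on `[-δ/2, δ/2]`, equal to `±1` outside.
  have hφ : Continuous fun s => max (-1) (min 1 (g s / (δ / 2))) := by fun_prop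
  have hφ1 : ∀ s, |max (-1) (min 1 (g s / (δ / 2)))| ≤ 1 := fun s =>
    abs_le.2 ⟨le_max_left _ _, max_le (by norm_num) (min_le_left _ _)⟩
  refine ⟨fun s => max (-1) (min 1 (g s / (δ / 2))), hφ, hφ1, ?_⟩
  have hφr : StronglyMeasurable[MeasurableSpace.comap r inferInstance]
      fun x => max (-1) (min 1 (g (r x) / (δ / 2))) :=
    (hφ.measurable.comp (comap_measurable r)).stronglyMeasurable
  rw [integral_mul_condExp hm hf hφr fun x => hφ1 _]
  have hdi : Integrable (fun x => |Y x - g (r x)|) μ := by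
    have := (integrable_map_measure (hyi.sub hgi).aestronglyMeasurable hr.aemeasurable).1
      (hyi.sub hgi)
    rw [hYy]
    exact this.abs
  have hd : ∫ x, |Y x - g (r x)| ∂μ ≤ δ / 4 := by
    rw [hYy]
    exact (integral_map hr.aemeasurable (hyi.sub hgi).norm.aestronglyMeasurable).symm.trans_le hg
  have hφY : Integrable (fun x => max (-1) (min 1 (g (r x) / (δ / 2))) * Y x) μ :=
    integrable_condExp.bdd_mul (hφr.mono hm).aestronglyMeasurable (ae_of_all _ fun x => hφ1 _)
  have hrest : Integrable (fun x => 2 * |Y x - g (r x)| + δ / 2) μ :=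
    (hdi.const_mul 2).add (integrable_const _)
  -- The clipped sign loses at most `δ / 2` at `b`, and passing from `b` to `a` costs `2 * |a - b|`.
  -- Since `|Y - g ∘ r|` integrates to at most `δ / 4`, the total error is `δ`.
  have key : ∀ a b : ℝ, |a| ≤ max (-1) (min 1 (b / (δ / 2))) * a + (2 * |a - b| + δ / 2) := by
    intro a b
    set p := max (-1) (min 1 (b / (δ / 2))) with hp
    have hp1 : |p| ≤ 1 := abs_le.2 ⟨le_max_left _ _, max_le (by norm_num) (min_le_left _ _)⟩
    have h1 : |b| ≤ p * b + δ / 2 := by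
      have hη : 0 < δ / 2 := by positivity
      rcases le_or_gt (δ / 2) b with h | h
      · have : p = 1 := by
          rw [hp, min_eq_left ((one_le_div hη).2 h), max_eq_right (by norm_num)]
        rw [this, abs_of_nonneg (hη.le.trans h)]
        linarith
      rcases le_or_gt b (-(δ / 2)) with h' | h'
      · have : p = -1 := by
          rw [hp]
          refine max_eq_left ((min_le_right _ _).trans ?_)
          rw [div_le_iff₀ hη]
          linarith
        rw [this, abs_of_nonpos (by linarith)]
        linarith
      · have hb1 : -1 ≤ b / (δ / 2) := by rw [le_div_iff₀ hη]; linarith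
        have hb2 : b / (δ / 2) ≤ 1 := by rw [div_le_iff₀ hη]; linarith
        have : p = b / (δ / 2) := by rw [hp, min_eq_right hb2, max_eq_right hb1]
        have hpb : 0 ≤ p * b := by
          rw [this, div_mul_eq_mul_div]
          exact div_nonneg (mul_self_nonneg b) hη.le
        have : |b| ≤ δ / 2 := abs_le.2 ⟨h'.le, h.le⟩
        linarith
    have h2 : p * (b - a) ≤ |a - b| := by
      calc p * (b - a) ≤ |p * (b - a)| := le_abs_self _
        _ = |p| * |a - b| := by rw [abs_mul, abs_sub_comm]
        _ ≤ _ := mul_le_of_le_one_left (abs_nonneg _) hp1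
    have h3 : |a| ≤ |b| + |a - b| := by
      have := abs_add_le b (a - b)
      rwa [add_sub_cancel] at this
    linarith [mul_sub p b a]
  calc ∫ x, |Y x| ∂μ
      ≤ ∫ x, (max (-1) (min 1 (g (r x) / (δ / 2))) * Y x
          + (2 * |Y x - g (r x)| + δ / 2)) ∂μ :=
        integral_mono integrable_condExp.abs
          (hφY.add hrest) fun x => key _ _
    _ = ∫ x, max (-1) (min 1 (g (r x) / (δ / 2))) * Y x ∂μ
          + (2 * ∫ x, |Y x - g (r x)| ∂μ + δ / 2) := by
        rw [integral_add hφY hrest, integral_add (hdi.const_mul 2) (integrable_const _),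
          integral_const_mul]
        simp
    _ ≤ _ := by linarith

end CondExp

/-! ### Transport plans and the relaxed martingale constraint -/

section Plans

variable {T d : ℕ} {μ : Marginals T d} {π : ProbabilityMeasure (PathSpace T d)}

lemma abs_coord_le_norm (x : PathSpace T d) (t : Fin T) (i : Fin d) : |x t i| ≤ ‖x‖ :=
  (norm_le_pi_norm (x t) i).trans (norm_le_pi_norm x t)

lemma norm_le_sum_abs (x : PathSpace T d) : ‖x‖ ≤ ∑ t, ∑ i, |x t i| := by
  refine (pi_norm_le_iff_of_nonneg (by positivity)).2 fun t =>
    (pi_norm_le_iff_of_nonneg (by positivity)).2 fun i => ?_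
  calc ‖x t i‖ ≤ ∑ j, |x t j| :=
        Finset.single_le_sum (f := fun j => |x t j|) (fun _ _ => abs_nonneg _) (Finset.mem_univ i)
    _ ≤ _ := Finset.single_le_sum (f := fun u => ∑ j, |x u j|)
        (fun _ _ => Finset.sum_nonneg fun _ _ => abs_nonneg _) (Finset.mem_univ t)

lemma measurable_coord (t : Fin T) (i : Fin d) : Measurable fun x : PathSpace T d => x t i :=
  (measurable_pi_apply i).comp (measurable_pi_apply t)

lemma continuous_coord (t : Fin T) (i : Fin d) : Continuous fun x : PathSpace T d => x t i :=
  (continuous_apply i).comp (continuous_apply t)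

lemma integrable_coord (hπ : π ∈ transportPlans μ) (t : Fin T) (i : Fin d) :
    Integrable (fun x => x t i) (π : Measure (PathSpace T d)) :=
  hπ.1.norm.mono' (measurable_coord t i).aestronglyMeasurable
    (ae_of_all _ fun x => abs_coord_le_norm x t i)

lemma integral_coord (hπ : π ∈ transportPlans μ) (t : Fin T) (i : Fin d) {f : ℝ → ℝ}
    (hf : Measurable f) :
    ∫ x, f (x t i) ∂(π : Measure (PathSpace T d)) = ∫ y, f y ∂(μ t i : Measure ℝ) := by
  rw [← hπ.2 t i, integral_map (measurable_coord t i).aemeasurable hf.aestronglyMeasurable]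

/-- The norm is at most the sum of the absolute coordinates, so integrability on path space follows
from the marginals. -/
lemma mem_transportPlans (hμ : μ.FiniteFirstMoments)
    (hπ : ∀ t i, (π : Measure (PathSpace T d)).map (fun x => x t i) = μ t i) :
    π ∈ transportPlans μ := by
  refine ⟨?_, hπ⟩
  have h : ∀ t i, Integrable (fun x => |x t i|) (π : Measure (PathSpace T d)) := fun t i => by
    have := hμ t i
    rw [← hπ t i] at this
    exact (this.comp_measurable (measurable_coord t i)).abs
  exact (integrable_finsetSum _ fun t _ => integrable_finsetSum _ fun i _ => h t i).mono'
    (by fun_prop) (ae_of_all _ norm_le_sum_abs)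

lemma stronglyMeasurable_coord (s : Fin T) (i : Fin d) :
    StronglyMeasurable[Filtration.piLE (X := fun _ : Fin T => Fin d → ℝ) s]
      fun x : PathSpace T d => x s i := by
  have : (fun x : PathSpace T d => x s i) =
      (fun y : Set.Iic s → Fin d → ℝ => y ⟨s, Set.mem_Iic.2 le_rfl⟩ i) ∘ Preorder.restrictLe s := rfl
  rw [this]
  exact (Measurable.comp (by fun_prop) (comap_measurable _)).stronglyMeasurable

/-- The increment `X_t - X_s` in the `i`-th coordinate, conditioned on the past of `s`. -/
lemma condMean_sub_ae_eq (hπ : π ∈ transportPlans μ) (s t : Fin T) (i : Fin d) :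
    (fun x => condMean π s t i x - x s i) =ᵐ[(π : Measure (PathSpace T d))]
      (π : Measure (PathSpace T d))[fun x => x t i - x s i |
        Filtration.piLE (X := fun _ : Fin T => Fin d → ℝ) s] := by
  have h := condExp_sub (integrable_coord hπ t i) (integrable_coord hπ s i)
    (Filtration.piLE (X := fun _ : Fin T => Fin d → ℝ) s)
  rw [condExp_of_stronglyMeasurable (Filtration.le _ s) (stronglyMeasurable_coord s i)
    (integrable_coord hπ s i)] at h
  exact h.symm

lemma integral_sum_abs_condMean_sub (hπ : π ∈ transportPlans μ) (s t : Fin T) :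
    ∫ x, ∑ i, |condMean π s t i x - x s i| ∂(π : Measure (PathSpace T d)) =
      ∑ i, ∫ x, |((π : Measure (PathSpace T d))[fun x => x t i - x s i |
        Filtration.piLE (X := fun _ : Fin T => Fin d → ℝ) s]) x|
          ∂(π : Measure (PathSpace T d)) := by
  have h := fun i => condMean_sub_ae_eq hπ s t i
  rw [integral_finsetSum]
  · refine Finset.sum_congr rfl fun i _ => integral_congr_ae ?_
    filter_upwards [h i] with x hx
    rw [hx]
  · exact fun i _ => (integrable_condExp.congr (h i).symm).abs

/-- The relaxed martingale constraint in terms of continuous test functions of the past. -/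
lemma integral_sum_abs_condMean_sub_le_iff (hπ : π ∈ transportPlans μ) (s t : Fin T) (ε : ℝ) :
    ∫ x, ∑ i, |condMean π s t i x - x s i| ∂(π : Measure (PathSpace T d)) ≤ ε ↔
      ∀ φ : Fin d → (Set.Iic s → Fin d → ℝ) → ℝ, (∀ i, Continuous (φ i)) →
        (∀ i y, |φ i y| ≤ 1) →
        ∑ i, ∫ x, φ i (Preorder.restrictLe s x) * (x t i - x s i)
          ∂(π : Measure (PathSpace T d)) ≤ ε := by
  have hi : ∀ i, Integrable (fun x => x t i - x s i) (π : Measure (PathSpace T d)) := fun i =>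
    (integrable_coord hπ t i).sub (integrable_coord hπ s i)
  rw [integral_sum_abs_condMean_sub hπ]
  constructor
  · intro h φ hφ hφ1
    refine le_trans (Finset.sum_le_sum fun i _ => ?_) h
    exact integral_mul_le_integral_abs_condExp (Filtration.le _ s) (hi i)
      ((hφ i).measurable.comp (comap_measurable _)).stronglyMeasurable fun x => hφ1 i _
  · intro h
    refine le_of_forall_pos_le_add fun δ hδ => ?_
    -- Each of the `d` coordinates gets an equal share; `d + 1` avoids division by zero.
    have hδ' : 0 < δ / (d + 1) := by positivity
    choose φ hφ hφ1 hφ2 using fun i => exists_integral_abs_condExp_le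
      (Preorder.measurable_restrictLe (X := fun _ : Fin T => Fin d → ℝ) s) (hi i) hδ'
    calc _ ≤ ∑ i, (∫ x, φ i (Preorder.restrictLe s x) * (x t i - x s i)
          ∂(π : Measure (PathSpace T d)) + δ / (d + 1)) := Finset.sum_le_sum fun i _ => hφ2 i
      _ ≤ ε + d * (δ / (d + 1)) := by
        rw [Finset.sum_add_distrib]
        simpa using h φ hφ hφ1
      _ ≤ ε + δ := by
        gcongr
        rw [mul_div_assoc', div_le_iff₀ (by positivity)]
        nlinarith

lemma relaxedPlans_mono {ε ε' : ℝ} (h : ε ≤ ε') : relaxedPlans ε μ ⊆ relaxedPlans ε' μ :=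
  fun _ hπ => ⟨hπ.1, fun s t hst => (hπ.2 s t hst).trans h⟩

/-- A sum of nonnegative integrals vanishes only if each integrand vanishes almost everywhere.
Closedness of the relaxed constraint thereby covers the martingale limit too. -/
lemma martingalePlans_eq_relaxedPlans_zero : martingalePlans μ = relaxedPlans 0 μ := by
  ext π
  refine and_congr_right fun hπ => forall_congr' fun s => forall_congr' fun t =>
    imp_congr_right fun _ => ?_
  have hi : ∀ i, Integrable (fun x => |condMean π s t i x - x s i|)
      (π : Measure (PathSpace T d)) := fun i =>
    (integrable_condExp.sub (integrable_coord hπ s i)).abs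
  have h0 : ∀ i, 0 ≤ ∫ x, |condMean π s t i x - x s i| ∂(π : Measure (PathSpace T d)) :=
    fun i => integral_nonneg fun x => abs_nonneg _
  rw [integral_finsetSum _ fun i _ => hi i]
  constructor
  · intro h
    refine le_of_eq (Finset.sum_eq_zero fun i _ => ?_)
    rw [integral_congr_ae (g := fun _ => 0) (by filter_upwards [h i] with x hx; simp [hx])]
    simp
  · intro h i
    have hz := (Finset.sum_eq_zero_iff_of_nonneg fun i _ => h0 i).1
      (le_antisymm h (Finset.sum_nonneg fun i _ => h0 i)) i (Finset.mem_univ i)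
    rw [integral_eq_zero_iff_of_nonneg (fun x => abs_nonneg _) (hi i)] at hz
    filter_upwards [hz] with x hx
    exact sub_eq_zero.1 (abs_eq_zero.1 hx)

/-- Here `h` need not be continuous: it will be composed with transport maps that are only
measurable. -/
lemma integral_mul_sub_eq_zero (hπ : π ∈ martingalePlans μ) {s t : Fin T}
    (hst : (s : ℕ) + 1 = (t : ℕ)) (i : Fin d) {h : PathSpace T d → ℝ}
    (hh : StronglyMeasurable[Filtration.piLE (X := fun _ : Fin T => Fin d → ℝ) s] h)
    {C : ℝ} (hC : ∀ x, |h x| ≤ C) :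
    ∫ x, h x * (x t i - x s i) ∂(π : Measure (PathSpace T d)) = 0 := by
  refine (integral_mul_condExp (Filtration.le _ s)
    ((integrable_coord hπ.1 t i).sub (integrable_coord hπ.1 s i)) hh hC).trans ?_
  refine integral_eq_zero_of_ae ?_
  filter_upwards [condMean_sub_ae_eq hπ.1 s t i, hπ.2 s t hst i] with x h1 h2
  exact mul_eq_zero_of_right _ (h1.symm.trans (sub_eq_zero.2 h2))

end Plans

/-! ### Wasserstein distance: couplings, Lipschitz integrands, weak convergence -/

section Wasserstein

variable {μ ν : ProbabilityMeasure ℝ} {γ : ProbabilityMeasure (ℝ × ℝ)}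

lemma integrable_comp_fst (hγ : γ ∈ couplings μ ν) {f : ℝ → ℝ}
    (hf : Integrable f (μ : Measure ℝ)) :
    Integrable (fun p => f p.1) (γ : Measure (ℝ × ℝ)) := by
  rw [← hγ.1] at hf
  exact hf.comp_measurable measurable_fst

lemma integrable_comp_snd (hγ : γ ∈ couplings μ ν) {f : ℝ → ℝ}
    (hf : Integrable f (ν : Measure ℝ)) :
    Integrable (fun p => f p.2) (γ : Measure (ℝ × ℝ)) := by
  rw [← hγ.2] at hf
  exact hf.comp_measurable measurable_snd

lemma integrable_abs_sub (hγ : γ ∈ couplings μ ν) (hμ : Integrable (fun y : ℝ => y) μ)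
    (hν : Integrable (fun y : ℝ => y) ν) :
    Integrable (fun p => |p.1 - p.2|) (γ : Measure (ℝ × ℝ)) :=
  ((integrable_comp_fst hγ hμ).sub (integrable_comp_snd hγ hν)).abs

/-- Nearly optimal couplings. -/
lemma exists_coupling_integral_lt (hμ : Integrable (fun y : ℝ => y) μ)
    (hν : Integrable (fun y : ℝ => y) ν) {δ : ℝ} (hδ : 0 < δ) :
    ∃ γ ∈ couplings μ ν,
      ∫ p, |p.1 - p.2| ∂(γ : Measure (ℝ × ℝ)) < (wasserstein μ ν).toReal + δ := by
  have hprod : μ.prod ν ∈ couplings μ ν := ⟨by simp, by simp⟩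
  have hfin : ∀ γ ∈ couplings μ ν,
      ENNReal.ofReal (∫ p, |p.1 - p.2| ∂(γ : Measure (ℝ × ℝ))) =
        ∫⁻ p, ENNReal.ofReal |p.1 - p.2| ∂(γ : Measure (ℝ × ℝ)) := fun γ hγ =>
    ofReal_integral_eq_lintegral_ofReal (integrable_abs_sub hγ hμ hν)
      (ae_of_all _ fun p => abs_nonneg _)
  -- The product coupling has finite cost.
  have hW : wasserstein μ ν ≠ ⊤ :=
    ne_top_of_le_ne_top (hfin _ hprod ▸ ENNReal.ofReal_ne_top) (iInf₂_le _ hprod)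
  have hlt : wasserstein μ ν < wasserstein μ ν + ENNReal.ofReal δ :=
    ENNReal.lt_add_right hW (by simpa using hδ)
  obtain ⟨γ, hγ⟩ := iInf_lt_iff.1 hlt
  obtain ⟨hγ, hlt⟩ := iInf_lt_iff.1 hγ
  refine ⟨γ, hγ, ?_⟩
  rw [← hfin γ hγ, ← ENNReal.ofReal_toReal hW,
    ← ENNReal.ofReal_add ENNReal.toReal_nonneg hδ.le] at hlt
  exact (ENNReal.ofReal_lt_ofReal_iff (by positivity)).1 hlt

/-- The easy half of Kantorovich–Rubinstein duality: integrate the Lipschitz bound against a nearly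
optimal coupling. -/
lemma abs_integral_sub_le (hμ : Integrable (fun y : ℝ => y) μ)
    (hν : Integrable (fun y : ℝ => y) ν) {φ : ℝ → ℝ} {L : NNReal} (hφ : LipschitzWith L φ) :
    |∫ y, φ y ∂(μ : Measure ℝ) - ∫ y, φ y ∂(ν : Measure ℝ)| ≤ L * (wasserstein μ ν).toReal := by
  have hint : ∀ {κ : ProbabilityMeasure ℝ}, Integrable (fun y : ℝ => y) κ →
      Integrable φ (κ : Measure ℝ) := fun {κ} h => by
    refine ((integrable_const |φ 0|).add (h.abs.const_mul L)).mono'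
      hφ.continuous.aestronglyMeasurable (ae_of_all _ fun y => ?_)
    have h1 := hφ.dist_le_mul y 0
    rw [Real.dist_eq, Real.dist_eq, sub_zero] at h1
    have h2 := abs_add_le (φ 0) (φ y - φ 0)
    rw [add_sub_cancel] at h2
    exact h2.trans (add_le_add_right h1 _)
  refine le_of_forall_pos_le_add fun δ hδ => ?_
  have hδ' : 0 < δ / (L + 1) := by positivity
  obtain ⟨γ, hγ, hlt⟩ := exists_coupling_integral_lt hμ hν hδ'
  have h1 : ∫ y, φ y ∂(μ : Measure ℝ) = ∫ p, φ p.1 ∂(γ : Measure (ℝ × ℝ)) := by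
    rw [← hγ.1, integral_map (by fun_prop) hφ.continuous.aestronglyMeasurable]
  have h2 : ∫ y, φ y ∂(ν : Measure ℝ) = ∫ p, φ p.2 ∂(γ : Measure (ℝ × ℝ)) := by
    rw [← hγ.2, integral_map (by fun_prop) hφ.continuous.aestronglyMeasurable]
  rw [h1, h2, ← integral_sub (integrable_comp_fst hγ (hint hμ)) (integrable_comp_snd hγ (hint hν))]
  calc |∫ p, (φ p.1 - φ p.2) ∂(γ : Measure (ℝ × ℝ))|
      ≤ ∫ p, |φ p.1 - φ p.2| ∂(γ : Measure (ℝ × ℝ)) := abs_integral_le_integral_abs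
    _ ≤ ∫ p, L * |p.1 - p.2| ∂(γ : Measure (ℝ × ℝ)) :=
        integral_mono ((integrable_comp_fst hγ (hint hμ)).sub
          (integrable_comp_snd hγ (hint hν))).abs
          ((integrable_abs_sub hγ hμ hν).const_mul _) fun p => by
            simpa [Real.dist_eq] using hφ.dist_le_mul p.1 p.2
    _ = L * ∫ p, |p.1 - p.2| ∂(γ : Measure (ℝ × ℝ)) := integral_const_mul _ _
    _ ≤ L * ((wasserstein μ ν).toReal + δ / (L + 1)) := by gcongr
    _ = L * (wasserstein μ ν).toReal + L * (δ / (L + 1)) := mul_add _ _ _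
    _ ≤ L * (wasserstein μ ν).toReal + δ := by
        gcongr
        rw [mul_div_assoc', div_le_iff₀ (by positivity)]
        nlinarith

lemma tendsto_integral_of_wasserstein {ν : ℕ → ProbabilityMeasure ℝ}
    (hν : ∀ n, Integrable (fun y : ℝ => y) (ν n : Measure ℝ))
    (hμ : Integrable (fun y : ℝ => y) (μ : Measure ℝ))
    (hW : Tendsto (fun n => (wasserstein (ν n) μ).toReal) atTop (𝓝 0))
    {φ : ℝ → ℝ} {L : NNReal} (hφ : LipschitzWith L φ) :
    Tendsto (fun n => ∫ y, φ y ∂(ν n : Measure ℝ)) atTop (𝓝 (∫ y, φ y ∂(μ : Measure ℝ))) := by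
  rw [tendsto_iff_norm_sub_tendsto_zero]
  refine squeeze_zero (fun n => norm_nonneg _) (fun n => abs_integral_sub_le (hν n) hμ hφ) ?_
  simpa using hW.const_mul (L : ℝ)

/-- Bounded Lipschitz test functions suffice for weak convergence. -/
lemma tendsto_of_wasserstein {ν : ℕ → ProbabilityMeasure ℝ}
    (hν : ∀ n, Integrable (fun y : ℝ => y) (ν n : Measure ℝ))
    (hμ : Integrable (fun y : ℝ => y) (μ : Measure ℝ))
    (hW : Tendsto (fun n => (wasserstein (ν n) μ).toReal) atTop (𝓝 0)) :
    Tendsto ν atTop (𝓝 μ) :=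
  tendsto_iff_forall_lipschitz_integral_tendsto.2 fun _ _ ⟨_, hφ⟩ =>
    tendsto_integral_of_wasserstein hν hμ hW hφ

lemma tendsto_integral_abs_of_wasserstein {ν : ℕ → ProbabilityMeasure ℝ}
    (hν : ∀ n, Integrable (fun y : ℝ => y) (ν n : Measure ℝ))
    (hμ : Integrable (fun y : ℝ => y) (μ : Measure ℝ))
    (hW : Tendsto (fun n => (wasserstein (ν n) μ).toReal) atTop (𝓝 0)) :
    Tendsto (fun n => ∫ y, |y| ∂(ν n : Measure ℝ)) atTop (𝓝 (∫ y, |y| ∂(μ : Measure ℝ))) :=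
  tendsto_integral_of_wasserstein hν hμ hW (L := 1) (LipschitzWith.of_dist_le_mul fun x y => by
    simpa [Real.dist_eq] using abs_abs_sub_abs_le_abs_sub x y)

variable {T d : ℕ}

lemma two_mul_sum_wasserstein_le_discrepancy (ν μ : Marginals T d) (t : Fin T) :
    2 * ∑ i, (wasserstein (ν t i) (μ t i)).toReal ≤ discrepancy ν μ :=
  mul_le_mul_of_nonneg_left
    (le_ciSup (f := fun t => ∑ i, (wasserstein (ν t i) (μ t i)).toReal)
      (Set.finite_range _).bddAbove t) zero_le_two

lemma tendsto_wasserstein_of_discrepancy {ν : ℕ → Marginals T d} {μ : Marginals T d}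
    (hr : Tendsto (fun n => discrepancy (ν n) μ) atTop (𝓝 0)) (t : Fin T) (i : Fin d) :
    Tendsto (fun n => (wasserstein (ν n t i) (μ t i)).toReal) atTop (𝓝 0) := by
  refine squeeze_zero (fun n => ENNReal.toReal_nonneg) (fun n => ?_) hr
  have h1 := two_mul_sum_wasserstein_le_discrepancy (ν n) μ t
  have h2 := Finset.single_le_sum (f := fun i => (wasserstein (ν n t i) (μ t i)).toReal)
    (fun _ _ => ENNReal.toReal_nonneg) (Finset.mem_univ i)
  have h3 : 0 ≤ (wasserstein (ν n t i) (μ t i)).toReal := ENNReal.toReal_nonneg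
  linarith

end Wasserstein

/-! ### Randomized transport of a martingale plan -/

section Randomization

/-- Every coupling is obtained from its second marginal by a transport map depending on an
independent uniform variable. -/
lemma exists_randomized_transport {ν μ : ProbabilityMeasure ℝ} {γ : ProbabilityMeasure (ℝ × ℝ)}
    (hγ : γ ∈ couplings ν μ) :
    ∃ f : ℝ → unitInterval → ℝ, Measurable (Function.uncurry f) ∧
      ((μ : Measure ℝ).prod (volume : Measure unitInterval)).map
        (fun p => (f p.1 p.2, p.1)) = γ := by
  -- The swap puts `μ` first, so that disintegration conditions on the source point; the kernel is
  -- then the law of a function of a uniform variable.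
  set η : Measure (ℝ × ℝ) := (γ : Measure (ℝ × ℝ)).map Prod.swap with hη
  have : IsProbabilityMeasure η := Measure.isProbabilityMeasure_map measurable_swap.aemeasurable
  have hfst : η.fst = μ := by
    rw [hη, Measure.fst_map_swap, Measure.snd, hγ.2]
  obtain ⟨f, hf, hfκ⟩ := η.condKernel.exists_measurable_map_eq_unitInterval
  refine ⟨f, hf, ?_⟩
  have hf' : Measurable fun p : ℝ × unitInterval => f p.1 p.2 := hf
  have h1 : ((μ : Measure ℝ).prod (volume : Measure unitInterval)).map
      (fun p => (p.1, f p.1 p.2)) = η := by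
    conv_rhs => rw [← η.disintegrate η.condKernel, hfst]
    ext s hs
    have hg : Measurable fun p : ℝ × unitInterval => (p.1, f p.1 p.2) := measurable_fst.prodMk hf'
    rw [Measure.map_apply hg hs, Measure.prod_apply (hg hs), Measure.compProd_apply hs]
    refine lintegral_congr fun a => ?_
    have hfa : Measurable (f a) := hf'.comp measurable_prodMk_left
    rw [← hfκ a, Measure.map_apply hfa (measurable_prodMk_left hs)]
    rfl
  have h2 : (γ : Measure (ℝ × ℝ)) = η.map Prod.swap := by
    rw [hη, Measure.map_map measurable_swap measurable_swap]
    simp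
  rw [h2, ← h1, Measure.map_map measurable_swap (measurable_fst.prodMk hf')]
  rfl

variable {T d : ℕ} {μ ν : Marginals T d} {π : ProbabilityMeasure (PathSpace T d)}

lemma dist_le_sum_abs (x y : PathSpace T d) : dist x y ≤ ∑ t, ∑ i, |x t i - y t i| := by
  rw [dist_eq_norm]
  exact norm_le_sum_abs (x - y)

lemma abs_sub_le_of_lipschitz {c : PathSpace T d → ℝ} {L : NNReal} (hc : LipschitzWith L c)
    (x y : PathSpace T d) : |c x - c y| ≤ L * ∑ t, ∑ i, |x t i - y t i| := by
  rw [← Real.dist_eq]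
  exact (hc.dist_le_mul x y).trans (by gcongr; exact dist_le_sum_abs x y)

lemma abs_le_of_lipschitz {c : PathSpace T d → ℝ} {L : NNReal} (hc : LipschitzWith L c)
    (x : PathSpace T d) : |c x| ≤ |c 0| + L * ∑ t, ∑ i, |x t i| := by
  have h1 := abs_sub_le_of_lipschitz hc x 0
  have h2 := abs_add_le (c 0) (c x - c 0)
  rw [add_sub_cancel] at h2
  simp only [Pi.zero_apply, sub_zero] at h1
  linarith

lemma integrable_sum_abs (hπ : π ∈ transportPlans μ) :
    Integrable (fun x => ∑ t, ∑ i, |x t i|) (π : Measure (PathSpace T d)) :=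
  integrable_finsetSum _ fun t _ => integrable_finsetSum _ fun i _ => (integrable_coord hπ t i).abs

lemma integrable_of_lipschitz (hπ : π ∈ transportPlans μ) {c : PathSpace T d → ℝ} {L : NNReal}
    (hc : LipschitzWith L c) : Integrable c (π : Measure (PathSpace T d)) :=
  ((integrable_const _).add ((integrable_sum_abs hπ).const_mul _)).mono'
    hc.continuous.aestronglyMeasurable (ae_of_all _ fun x => abs_le_of_lipschitz hc x)

/-- Moving the marginals of a martingale plan along couplings yields a relaxed plan. -/
lemma exists_relaxedPlan_of_couplings (hπ : π ∈ martingalePlans μ) (hμ : μ.FiniteFirstMoments)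
    (hν : ν.FiniteFirstMoments) {γ : Fin T → Fin d → ProbabilityMeasure (ℝ × ℝ)}
    (hγ : ∀ t i, γ t i ∈ couplings (ν t i) (μ t i)) {ε : ℝ}
    (hε : ∀ s t, ∑ i, (∫ p, |p.1 - p.2| ∂(γ t i : Measure (ℝ × ℝ)) +
      ∫ p, |p.1 - p.2| ∂(γ s i : Measure (ℝ × ℝ))) ≤ ε) :
    ∃ π' ∈ relaxedPlans ε ν, ∀ (c : PathSpace T d → ℝ) (L : NNReal), LipschitzWith L c →
      |∫ x, c x ∂(π' : Measure (PathSpace T d)) - ∫ x, c x ∂(π : Measure (PathSpace T d))| ≤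
        L * ∑ t, ∑ i, ∫ p, |p.1 - p.2| ∂(γ t i : Measure (ℝ × ℝ)) := by
  choose f hf hfγ using fun t i => exists_randomized_transport (hγ t i)
  have hf' : ∀ t i, Measurable fun p : ℝ × unitInterval => f t i p.1 p.2 := hf
  set Q : Measure (PathSpace T d × unitInterval) :=
    (π : Measure (PathSpace T d)).prod volume with hQ
  -- One uniform variable serves all times and coordinates: only the law of each pair `(Y t i, X t
  -- i)` is prescribed.
  set Y : PathSpace T d × unitInterval → PathSpace T d := fun p t i => f t i (p.1 t i) p.2
  have hXm : ∀ t i, Measurable fun p : PathSpace T d × unitInterval => p.1 t i := fun t i =>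
    (measurable_coord t i).comp measurable_fst
  have hYtm : ∀ t i, Measurable fun p => Y p t i := fun t i =>
    (hf' t i).comp ((hXm t i).prodMk measurable_snd)
  have hYm : Measurable Y := measurable_pi_lambda _ fun t => measurable_pi_lambda _ fun i => hYtm t i
  have hjoint : ∀ t i, Q.map (fun p => (Y p t i, p.1 t i)) = γ t i := fun t i => by
    rw [← hfγ t i, ← hπ.1.2 t i]
    have : ((π : Measure (PathSpace T d)).map fun x => x t i).prod
        (volume : Measure unitInterval) =
        Q.map (Prod.map (fun x => x t i) id) := by
      rw [hQ, ← Measure.map_prod_map _ _ (measurable_coord t i) measurable_id, Measure.map_id]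
    rw [this, Measure.map_map ((hf' t i).prodMk measurable_fst)
      ((measurable_coord t i).prodMap measurable_id)]
    rfl
  have hpair : ∀ t i, Measurable fun p => (Y p t i, p.1 t i) := fun t i =>
    (hYtm t i).prodMk (hXm t i)
  have hcost : ∀ t i, ∫ p, |Y p t i - p.1 t i| ∂Q =
      ∫ p, |p.1 - p.2| ∂(γ t i : Measure (ℝ × ℝ)) := fun t i => by
    rw [← hjoint t i, integral_map (hpair t i).aemeasurable (by fun_prop)]
  have hcosti : ∀ t i, Integrable (fun p => Y p t i - p.1 t i) Q := fun t i => by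
    have := (integrable_comp_fst (hγ t i) (hν t i)).sub (integrable_comp_snd (hγ t i) (hμ t i))
    rw [← hjoint t i] at this
    exact this.comp_measurable (hpair t i)
  have : IsProbabilityMeasure (Q.map Y) := Measure.isProbabilityMeasure_map hYm.aemeasurable
  set π' : ProbabilityMeasure (PathSpace T d) := ⟨Q.map Y, this⟩
  have hcoe : (π' : Measure (PathSpace T d)) = Q.map Y := rfl
  have hplan : π' ∈ transportPlans ν := by
    refine mem_transportPlans hν fun t i => ?_
    rw [hcoe, Measure.map_map (measurable_coord t i) hYm, ← (hγ t i).1, ← hjoint t i,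
      Measure.map_map measurable_fst (hpair t i)]
    rfl
  have hfstQ : Q.map Prod.fst = π := by
    rw [hQ, Measure.map_fst_prod]
    simp
  have hfi : ∀ {g : PathSpace T d → ℝ}, Integrable g (π : Measure (PathSpace T d)) →
      Integrable (fun p => g p.1) Q := fun h => h.comp_fst _
  refine ⟨π', ⟨hplan, fun s t hst => ?_⟩, fun c L hc => ?_⟩
  · refine (integral_sum_abs_condMean_sub_le_iff hplan s t ε).2 fun φ hφ hφ1 => ?_
    refine le_trans (Finset.sum_le_sum fun i _ => ?_) (hε s t)
    set H : PathSpace T d × unitInterval → ℝ := fun p => φ i (Preorder.restrictLe s (Y p)) with hH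
    have hHm : Measurable H := (hφ i).measurable.comp
      ((Preorder.measurable_restrictLe (X := fun _ : Fin T => Fin d → ℝ) s).comp hYm)
    have hmul : ∀ {g : PathSpace T d × unitInterval → ℝ}, Integrable g Q →
        Integrable (fun p => H p * g p) Q := fun hg =>
      hg.bdd_mul hHm.aestronglyMeasurable (ae_of_all _ fun p => hφ1 i _)
    have hle : ∀ {g : PathSpace T d × unitInterval → ℝ}, Integrable g Q →
        |∫ p, H p * g p ∂Q| ≤ ∫ p, |g p| ∂Q := fun hg =>
      abs_integral_le_integral_abs.trans (integral_mono (hmul hg).abs hg.abs fun p => by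
        simp only [abs_mul]
        exact mul_le_of_le_one_left (abs_nonneg _) (hφ1 i _))
    have hXi : Integrable (fun p : PathSpace T d × unitInterval => p.1 t i - p.1 s i) Q :=
      hfi ((integrable_coord hπ.1 t i).sub (integrable_coord hπ.1 s i))
    -- For fixed `u`, the past of `Y` is a function of the past of `X`, so the martingale property
    -- applies; then integrate over `u`.
    have hzero : ∫ p, H p * (p.1 t i - p.1 s i) ∂Q = 0 := by
      rw [hQ, integral_prod_symm _ (hmul hXi)]
      refine integral_eq_zero_of_ae (ae_of_all _ fun u => ?_)
      refine integral_mul_sub_eq_zero hπ hst i (h := fun x => H (x, u)) ?_ (fun x => hφ1 i _)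
      have hG : Measurable fun y : Set.Iic s → Fin d → ℝ =>
          φ i (fun r j => f r j (y r j) u) := by
        refine (hφ i).measurable.comp (measurable_pi_lambda _ fun r =>
          measurable_pi_lambda _ fun j => (hf' r j).comp (Measurable.prodMk ?_ measurable_const))
        fun_prop
      have hcomp : (fun x => H (x, u)) = (fun y : Set.Iic s → Fin d → ℝ =>
          φ i (fun r j => f r j (y r j) u)) ∘ Preorder.restrictLe s := rfl
      rw [hcomp]
      exact (hG.comp (comap_measurable _)).stronglyMeasurable
    -- `Y t - Y s = (Y t - X t) + (X t - X s) - (Y s - X s)`; the middle term integrates to zero and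
    -- the others are bounded by transport costs.
    have hsplit : ∫ x, φ i (Preorder.restrictLe s x) * (x t i - x s i)
        ∂(π' : Measure (PathSpace T d)) =
        ∫ p, H p * (Y p t i - p.1 t i) ∂Q + ∫ p, H p * (p.1 t i - p.1 s i) ∂Q
          - ∫ p, H p * (Y p s i - p.1 s i) ∂Q := by
      have hadd : Integrable
          (fun p => H p * (Y p t i - p.1 t i) + H p * (p.1 t i - p.1 s i)) Q :=
        (hmul (hcosti t i)).add (hmul hXi)
      rw [hcoe, integral_map hYm.aemeasurable, ← integral_add (hmul (hcosti t i)) (hmul hXi),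
        ← integral_sub hadd (hmul (hcosti s i))]
      · refine integral_congr_ae (ae_of_all _ fun p => ?_)
        simp only [hH]
        ring
      · exact (((hφ i).measurable.comp (Preorder.measurable_restrictLe
          (X := fun _ : Fin T => Fin d → ℝ) s)).mul
          ((measurable_coord t i).sub (measurable_coord s i))).aestronglyMeasurable
    rw [hsplit, hzero, ← hcost t i, ← hcost s i]
    have h1 := le_of_abs_le (hle (hcosti t i))
    have h2 := neg_le_of_abs_le (hle (hcosti s i))
    linarith
  · have hci := integrable_of_lipschitz hplan hc
    have hcY : Integrable (fun p => c (Y p)) Q := by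
      rw [hcoe] at hci
      exact hci.comp_measurable hYm
    have hcX : Integrable (fun p : PathSpace T d × unitInterval => c p.1) Q :=
      hfi (integrable_of_lipschitz hπ.1 hc)
    have h1 : ∫ x, c x ∂(π' : Measure (PathSpace T d)) = ∫ p, c (Y p) ∂Q := by
      rw [hcoe, integral_map hYm.aemeasurable hc.continuous.aestronglyMeasurable]
    have h2 : ∫ x, c x ∂(π : Measure (PathSpace T d)) = ∫ p, c p.1 ∂Q := by
      rw [← hfstQ, integral_map measurable_fst.aemeasurable hc.continuous.aestronglyMeasurable]
    have hsum : Integrable (fun p => ∑ t, ∑ i, |Y p t i - p.1 t i|) Q :=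
      integrable_finsetSum _ fun t _ => integrable_finsetSum _ fun i _ => (hcosti t i).abs
    rw [h1, h2, ← integral_sub hcY hcX]
    calc |∫ p, (c (Y p) - c p.1) ∂Q| ≤ ∫ p, |c (Y p) - c p.1| ∂Q := abs_integral_le_integral_abs
      _ ≤ ∫ p, L * ∑ t, ∑ i, |Y p t i - p.1 t i| ∂Q :=
          integral_mono (hcY.sub hcX).abs (hsum.const_mul _) fun p =>
            abs_sub_le_of_lipschitz hc _ _
      _ = L * ∑ t, ∑ i, ∫ p, |Y p t i - p.1 t i| ∂Q := by
          rw [integral_const_mul, integral_finsetSum _ fun t _ =>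
            integrable_finsetSum _ fun i _ => (hcosti t i).abs]
          congr 1
          exact Finset.sum_congr rfl fun t _ => integral_finsetSum _ fun i _ => (hcosti t i).abs
      _ = _ := by simp only [hcost]

end Randomization

/-! ### Tightness and weak limits of relaxed plans -/

section Compactness

variable {T d : ℕ}

/-- Markov's inequality bounds the mass outside balls uniformly, and closed balls are compact. -/
lemma isTightMeasureSet_of_integral_norm_le {E ι : Type*} [NormedAddCommGroup E] [ProperSpace E]
    [MeasurableSpace E] {π : ι → ProbabilityMeasure E}
    (hπ : ∀ n, Integrable (fun x => ‖x‖) (π n : Measure E)) {C : ℝ}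
    (hC : ∀ n, ∫ x, ‖x‖ ∂(π n : Measure E) ≤ C) :
    IsTightMeasureSet (Set.range fun n => (π n : Measure E)) := by
  refine isTightMeasureSet_of_tendsto_measure_norm_gt ?_
  have hlim : Tendsto (fun r : ℝ => ENNReal.ofReal (C / r)) atTop (𝓝 0) := by
    simpa [Function.comp_def] using (ENNReal.continuous_ofReal.tendsto _).comp
      (tendsto_const_nhds.div_atTop tendsto_id : Tendsto (fun r : ℝ => C / r) atTop (𝓝 0))
  refine tendsto_of_tendsto_of_tendsto_of_le_of_le' tendsto_const_nhds hlim
    (Eventually.of_forall fun _ => zero_le) ?_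
  filter_upwards [eventually_gt_atTop 0] with r hr
  refine iSup₂_le ?_
  rintro _ ⟨n, rfl⟩
  have h := mul_meas_ge_le_integral_of_nonneg (ae_of_all _ fun x => norm_nonneg x) (hπ n) r
  calc (π n : Measure E) {x | r < ‖x‖} ≤ (π n : Measure E) {x | r ≤ ‖x‖} :=
        measure_mono fun x (hx : r < ‖x‖) => hx.le
    _ = ENNReal.ofReal ((π n : Measure E).real {x | r ≤ ‖x‖}) := by simp
    _ ≤ ENNReal.ofReal (C / r) := by
        refine ENNReal.ofReal_le_ofReal ((le_div_iff₀ hr).2 ?_)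
        rw [mul_comm]
        exact h.trans (hC n)

lemma integral_sum_abs {μ : Marginals T d} {π : ProbabilityMeasure (PathSpace T d)}
    (hπ : π ∈ transportPlans μ) :
    ∫ x, ∑ t, ∑ i, |x t i| ∂(π : Measure (PathSpace T d)) =
      ∑ t, ∑ i, ∫ y, |y| ∂(μ t i : Measure ℝ) := by
  rw [integral_finsetSum _ fun t _ =>
    integrable_finsetSum _ fun i _ => (integrable_coord hπ t i).abs]
  refine Finset.sum_congr rfl fun t _ => ?_
  rw [integral_finsetSum _ fun i _ => (integrable_coord hπ t i).abs]
  exact Finset.sum_congr rfl fun i _ => integral_coord hπ t i (by fun_prop)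

/-- Plans whose marginals have bounded first moments are tight. -/
lemma isTightMeasureSet_of_transportPlans {ι : Type*} {ν : ι → Marginals T d}
    {π : ι → ProbabilityMeasure (PathSpace T d)} (hπ : ∀ n, π n ∈ transportPlans (ν n)) {C : ℝ}
    (hC : ∀ n, ∑ t, ∑ i, ∫ y, |y| ∂(ν n t i : Measure ℝ) ≤ C) :
    IsTightMeasureSet (Set.range fun n => (π n : Measure (PathSpace T d))) :=
  isTightMeasureSet_of_integral_norm_le (fun n => (hπ n).1.norm) fun n =>
    (integral_mono (hπ n).1.norm (integrable_sum_abs (hπ n)) norm_le_sum_abs).trans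
      ((integral_sum_abs (hπ n)).trans_le (hC n))

/-- Prokhorov's theorem; limits along ultrafilters take the place of subsequences. -/
lemma exists_tendsto_ultrafilter {Ω ι : Type*} [TopologicalSpace Ω] [MeasurableSpace Ω]
    [BorelSpace Ω] [T2Space Ω] {π : ι → ProbabilityMeasure Ω}
    (hπ : IsTightMeasureSet (Set.range fun n => (π n : Measure Ω))) (F : Ultrafilter ι) :
    ∃ ρ, Tendsto π F (𝓝 ρ) := by
  have hS : IsTightMeasureSet {((μ : ProbabilityMeasure Ω) : Measure Ω) | μ ∈ Set.range π} := by
    refine hπ.subset ?_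
    rintro _ ⟨_, ⟨n, rfl⟩, rfl⟩
    exact ⟨n, rfl⟩
  obtain ⟨ρ, -, hρ⟩ := (isCompact_closure_of_isTightMeasureSet hS).ultrafilter_le_nhds (F.map π)
    (le_principal_iff.2 (mem_of_superset (range_mem_map (m := π)) subset_closure))
  exact ⟨ρ, hρ⟩

section Limit

variable {ι : Type*} {F : Filter ι} {ν : ι → Marginals T d} {μ : Marginals T d}
  {π : ι → ProbabilityMeasure (PathSpace T d)} {ρ : ProbabilityMeasure (PathSpace T d)}

lemma mem_transportPlans_of_tendsto [F.NeBot] (hμ : μ.FiniteFirstMoments)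
    (hν : ∀ t i, Tendsto (fun n => ν n t i) F (𝓝 (μ t i)))
    (hπ : ∀ n, π n ∈ transportPlans (ν n)) (hρ : Tendsto π F (𝓝 ρ)) : ρ ∈ transportPlans μ := by
  refine mem_transportPlans hμ fun t i => ?_
  have h1 := ProbabilityMeasure.tendsto_map_of_tendsto_of_continuous π ρ hρ (continuous_coord t i)
  have h2 : (fun n => (π n).map (continuous_coord t i).aemeasurable) = fun n => ν n t i := by
    funext n
    exact Subtype.ext ((hπ n).2 t i)
  rw [h2] at h1
  have h3 : ρ.map (continuous_coord t i).aemeasurable = μ t i := tendsto_nhds_unique h1 (hν t i)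
  exact congrArg (fun κ : ProbabilityMeasure ℝ => (κ : Measure ℝ)) h3

/-- The dominating function is a sum over single coordinates, so its integral depends on the
marginals alone and converges by `hm`. -/
lemma tendsto_integral_of_linear_growth
    (hm : ∀ t i, Tendsto (fun n => ∫ y, |y| ∂(ν n t i : Measure ℝ)) F
      (𝓝 (∫ y, |y| ∂(μ t i : Measure ℝ))))
    (hπ : ∀ n, π n ∈ transportPlans (ν n)) (hρμ : ρ ∈ transportPlans μ)
    (hρ : Tendsto π F (𝓝 ρ)) {f : PathSpace T d → ℝ} (hf : Continuous f) {A B : ℝ}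
    (hfG : ∀ x, |f x| ≤ A + B * ∑ t, ∑ i, |x t i|) :
    Tendsto (fun n => ∫ x, f x ∂(π n : Measure (PathSpace T d))) F
      (𝓝 (∫ x, f x ∂(ρ : Measure (PathSpace T d)))) := by
  have hint : ∀ {κ : Marginals T d} {η : ProbabilityMeasure (PathSpace T d)},
      η ∈ transportPlans κ → Integrable (fun x => A + B * ∑ t, ∑ i, |x t i|)
        (η : Measure (PathSpace T d)) := fun h =>
    (integrable_const _).add ((integrable_sum_abs h).const_mul _)
  have hval : ∀ {κ : Marginals T d} {η : ProbabilityMeasure (PathSpace T d)},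
      η ∈ transportPlans κ → ∫ x, (A + B * ∑ t, ∑ i, |x t i|) ∂(η : Measure (PathSpace T d)) =
        A + B * ∑ t, ∑ i, ∫ y, |y| ∂(κ t i : Measure ℝ) := fun h => by
    rw [integral_add (integrable_const _) ((integrable_sum_abs h).const_mul _),
      integral_const_mul, integral_sum_abs h]
    simp
  refine tendsto_integral_of_dominated hρ hf ?_ hfG (hint hρμ) (fun n => hint (hπ n)) ?_
  · exact continuous_const.add (continuous_const.mul (continuous_finsetSum _ fun t _ =>
      continuous_finsetSum _ fun i _ => (continuous_coord t i).abs))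
  · rw [hval hρμ, funext fun n => hval (hπ n)]
    exact tendsto_const_nhds.add ((tendsto_finsetSum _ fun t _ =>
      tendsto_finsetSum _ fun i _ => hm t i).const_mul B)

lemma tendsto_integral_of_lipschitz
    (hm : ∀ t i, Tendsto (fun n => ∫ y, |y| ∂(ν n t i : Measure ℝ)) F
      (𝓝 (∫ y, |y| ∂(μ t i : Measure ℝ))))
    (hπ : ∀ n, π n ∈ transportPlans (ν n)) (hρμ : ρ ∈ transportPlans μ)
    (hρ : Tendsto π F (𝓝 ρ)) {c : PathSpace T d → ℝ} {L : NNReal} (hc : LipschitzWith L c) :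
    Tendsto (fun n => ∫ x, c x ∂(π n : Measure (PathSpace T d))) F
      (𝓝 (∫ x, c x ∂(ρ : Measure (PathSpace T d)))) :=
  tendsto_integral_of_linear_growth hm hπ hρμ hρ hc.continuous (abs_le_of_lipschitz hc)

/-- Relaxed plans are stable under weak limits when the first moments of the marginals converge. -/
lemma mem_relaxedPlans_of_tendsto [F.NeBot] (hμ : μ.FiniteFirstMoments)
    (hν : ∀ t i, Tendsto (fun n => ν n t i) F (𝓝 (μ t i)))
    (hm : ∀ t i, Tendsto (fun n => ∫ y, |y| ∂(ν n t i : Measure ℝ)) F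
      (𝓝 (∫ y, |y| ∂(μ t i : Measure ℝ))))
    {ε : ι → ℝ} {ε₀ : ℝ} (hε : Tendsto ε F (𝓝 ε₀))
    (hπ : ∀ n, π n ∈ relaxedPlans (ε n) (ν n)) (hρ : Tendsto π F (𝓝 ρ)) :
    ρ ∈ relaxedPlans ε₀ μ := by
  have hρμ := mem_transportPlans_of_tendsto hμ hν (fun n => (hπ n).1) hρ
  refine ⟨hρμ, fun s t hst => ?_⟩
  refine (integral_sum_abs_condMean_sub_le_iff hρμ s t ε₀).2 fun φ hφ hφ1 => ?_
  refine le_of_tendsto_of_tendsto' (tendsto_finsetSum _ fun i _ =>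
    tendsto_integral_of_linear_growth hm (fun n => (hπ n).1) hρμ hρ (A := 0) (B := 2) ?_ ?_)
    hε fun n => (integral_sum_abs_condMean_sub_le_iff (hπ n).1 s t (ε n)).1
      ((hπ n).2 s t hst) φ hφ hφ1
  · exact ((hφ i).comp (continuous_pi fun r => continuous_apply _)).mul
      ((continuous_coord t i).sub (continuous_coord s i))
  · intro x
    have hle : ∀ u, |x u i| ≤ ∑ t, ∑ i, |x t i| := fun u =>
      (Finset.single_le_sum (f := fun j => |x u j|) (fun _ _ => abs_nonneg _)
        (Finset.mem_univ i)).trans (Finset.single_le_sum (f := fun u => ∑ j, |x u j|)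
        (fun _ _ => Finset.sum_nonneg fun _ _ => abs_nonneg _) (Finset.mem_univ u))
    rw [abs_mul]
    calc _ ≤ |x t i - x s i| := mul_le_of_le_one_left (abs_nonneg _) (hφ1 i _)
      _ ≤ |x t i| + |x s i| := abs_sub _ _
      _ ≤ _ := by linarith [hle t, hle s]

end Limit

/-- A sequence of relaxed plans with fixed marginals has a limit along any ultrafilter. -/
lemma exists_limit_of_relaxedPlans {ν : Marginals T d} (hν : ν.FiniteFirstMoments)
    {π : ℕ → ProbabilityMeasure (PathSpace T d)} {ε : ℕ → ℝ} {ε₀ : ℝ} {F : Ultrafilter ℕ}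
    (hε : Tendsto ε F (𝓝 ε₀)) (hπ : ∀ n, π n ∈ relaxedPlans (ε n) ν) :
    ∃ ρ ∈ relaxedPlans ε₀ ν, ∀ (c : PathSpace T d → ℝ) (L : NNReal), LipschitzWith L c →
      Tendsto (fun n => ∫ x, c x ∂(π n : Measure (PathSpace T d))) F
        (𝓝 (∫ x, c x ∂(ρ : Measure (PathSpace T d)))) := by
  obtain ⟨ρ, hρ⟩ := exists_tendsto_ultrafilter
    (isTightMeasureSet_of_transportPlans (fun n => (hπ n).1) fun _ => le_rfl) F
  have hmem := mem_relaxedPlans_of_tendsto hν (fun _ _ => tendsto_const_nhds)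
    (fun _ _ => tendsto_const_nhds) hε hπ hρ
  exact ⟨ρ, hmem, fun c L hc => tendsto_integral_of_lipschitz (ν := fun _ => ν)
    (fun _ _ => tendsto_const_nhds) (fun n => (hπ n).1) hmem.1 hρ hc⟩

/-- A martingale plan is approximated by relaxed plans with nearby marginals. -/
lemma exists_relaxedPlan {μ ν : Marginals T d} {π : ProbabilityMeasure (PathSpace T d)}
    (hπ : π ∈ martingalePlans μ) (hμ : μ.FiniteFirstMoments) (hν : ν.FiniteFirstMoments) :
    ∃ π' ∈ relaxedPlans (discrepancy ν μ) ν,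
      ∀ (c : PathSpace T d → ℝ) (L : NNReal), LipschitzWith L c →
        |∫ x, c x ∂(π' : Measure (PathSpace T d)) - ∫ x, c x ∂(π : Measure (PathSpace T d))| ≤
          L * ∑ t, ∑ i, (wasserstein (ν t i) (μ t i)).toReal := by
  have hδ : ∀ n : ℕ, (0 : ℝ) < 1 / (n + 1) := fun n => by positivity
  have hlim : Tendsto (fun n : ℕ => 1 / ((n : ℝ) + 1)) (hyperfilter ℕ : Filter ℕ) (𝓝 0) :=
    tendsto_one_div_add_atTop_nhds_zero_nat.mono_left Nat.hyperfilter_le_atTop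
  choose γ hγ hlt using fun n t i => exists_coupling_integral_lt (hν t i) (hμ t i) (hδ n)
  -- The slack `1 / (n + 1)` occurs for `d` coordinates at each of two times, hence `2 * d`. The
  -- maximum over times in `discrepancy` is doubled to cover both `s` and `t`.
  have hcost : ∀ n s t, ∑ i, (∫ p, |p.1 - p.2| ∂(γ n t i : Measure (ℝ × ℝ)) +
      ∫ p, |p.1 - p.2| ∂(γ n s i : Measure (ℝ × ℝ))) ≤
        discrepancy ν μ + 2 * d * (1 / (n + 1)) := by
    intro n s t
    have h : ∀ u, ∑ i, ∫ p, |p.1 - p.2| ∂(γ n u i : Measure (ℝ × ℝ)) ≤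
        ∑ i, (wasserstein (ν u i) (μ u i)).toReal + d * (1 / (n + 1)) := fun u => by
      refine (Finset.sum_le_sum fun i _ => (hlt n u i).le).trans_eq ?_
      simp [Finset.sum_add_distrib]
    rw [Finset.sum_add_distrib]
    linarith [h s, h t, two_mul_sum_wasserstein_le_discrepancy ν μ s,
      two_mul_sum_wasserstein_le_discrepancy ν μ t]
  choose π' hπ' hc using fun n => exists_relaxedPlan_of_couplings hπ hμ hν (hγ n) (hcost n)
  have hε : Tendsto (fun n : ℕ => discrepancy ν μ + 2 * d * (1 / ((n : ℝ) + 1)))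
      (hyperfilter ℕ : Filter ℕ) (𝓝 (discrepancy ν μ)) := by
    simpa using tendsto_const_nhds.add (hlim.const_mul (2 * (d : ℝ)))
  -- The marginals `ν` stay fixed along this limit; only the slack disappears.
  obtain ⟨ρ, hρ, hρc⟩ := exists_limit_of_relaxedPlans hν hε hπ'
  refine ⟨ρ, hρ, fun c L hL => ?_⟩
  refine le_of_tendsto_of_tendsto' (((hρc c L hL).sub_const _).abs)
    (?_ : Tendsto (fun n : ℕ => (L : ℝ) * ∑ t, ∑ i,
      ((wasserstein (ν t i) (μ t i)).toReal + 1 / ((n : ℝ) + 1))) _ _) fun n => ?_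
  · refine Tendsto.const_mul _ (tendsto_finsetSum _ fun t _ => tendsto_finsetSum _ fun i _ => ?_)
    simpa using tendsto_const_nhds.add hlim
  · refine (hc n c L hL).trans ?_
    gcongr with t _ i _
    exact (hlt n t i).le

end Compactness

/-! ### Existence and stability of optimizers -/

section Optimization

variable {T d : ℕ}

lemma le_upperValue {c : PathSpace T d → ℝ} {S : Set (ProbabilityMeasure (PathSpace T d))}
    {π : ProbabilityMeasure (PathSpace T d)} (hπ : π ∈ S) :
    ((∫ x, c x ∂(π : Measure (PathSpace T d)) : ℝ) : EReal) ≤ upperValue c S :=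
  le_iSup₂ (f := fun (π : ProbabilityMeasure (PathSpace T d)) (_ : π ∈ S) =>
    ((∫ x, c x ∂(π : Measure (PathSpace T d)) : ℝ) : EReal)) π hπ

lemma isMaximizer_iff {c : PathSpace T d → ℝ} {S : Set (ProbabilityMeasure (PathSpace T d))}
    {π : ProbabilityMeasure (PathSpace T d)} :
    IsMaximizer c S π ↔ π ∈ S ∧ ∀ π' ∈ S, ∫ x, c x ∂(π' : Measure (PathSpace T d)) ≤
      ∫ x, c x ∂(π : Measure (PathSpace T d)) := by
  refine and_congr_right fun hπ => ⟨fun h π' hπ' => ?_, fun h => ?_⟩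
  · exact EReal.coe_le_coe_iff.1 ((le_upperValue hπ').trans_eq h.symm)
  · exact le_antisymm (le_upperValue hπ) (iSup₂_le fun π' hπ' => EReal.coe_le_coe_iff.2 (h π' hπ'))

lemma exists_isMaximizer {ν : Marginals T d} (hν : ν.FiniteFirstMoments) {ε : ℝ}
    (hne : (relaxedPlans ε ν).Nonempty) {c : PathSpace T d → ℝ} {L : NNReal}
    (hc : LipschitzWith L c) : ∃ π, IsMaximizer c (relaxedPlans ε ν) π := by
  -- A maximizing sequence, taken in `EReal` so that no bound on the supremum is needed beforehand.
  obtain ⟨u, -, hu, huS⟩ := exists_seq_tendsto_sSup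
    (hne.image fun π : ProbabilityMeasure (PathSpace T d) =>
      ((∫ x, c x ∂(π : Measure (PathSpace T d)) : ℝ) : EReal))
    (OrderTop.bddAbove _)
  choose π hπ hπu using huS
  obtain ⟨ρ, hρ, hlim⟩ := exists_limit_of_relaxedPlans (F := hyperfilter ℕ) hν
    tendsto_const_nhds hπ
  refine ⟨ρ, hρ, ?_⟩
  rw [upperValue, ← sSup_image]
  refine tendsto_nhds_unique ?_ (hu.mono_left Nat.hyperfilter_le_atTop)
  rw [← funext hπu]
  exact (continuous_coe_real_ereal.tendsto _).comp (hlim c L hc)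

lemma lowerValue_eq_neg_upperValue (c : PathSpace T d → ℝ)
    (S : Set (ProbabilityMeasure (PathSpace T d))) :
    lowerValue c S = -upperValue (fun x => -c x) S := by
  apply le_antisymm
  · refine EReal.le_neg_of_le_neg (iSup₂_le fun π hπ => ?_)
    rw [integral_neg, EReal.coe_neg]
    exact EReal.neg_le_neg_iff.2 (iInf₂_le π hπ)
  · refine le_iInf₂ fun π hπ => EReal.neg_le_of_neg_le ?_
    rw [← EReal.coe_neg, ← integral_neg]
    exact le_upperValue (c := fun x => -c x) hπ

lemma isMinimizer_iff_isMaximizer_neg (c : PathSpace T d → ℝ)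
    (S : Set (ProbabilityMeasure (PathSpace T d))) (π : ProbabilityMeasure (PathSpace T d)) :
    IsMinimizer c S π ↔ IsMaximizer (fun x => -c x) S π := by
  refine and_congr_right fun _ => ?_
  rw [lowerValue_eq_neg_upperValue, integral_neg, EReal.coe_neg, neg_eq_iff_eq_neg]

section Stability

variable {μ : Marginals T d} (hμ : μ.FiniteFirstMoments) {ν : ℕ → Marginals T d}
  (hν : ∀ n, (ν n).FiniteFirstMoments)
  (hr : Tendsto (fun n => discrepancy (ν n) μ) atTop (𝓝 0))

include hμ hν hr

lemma isTightMeasureSet_of_discrepancy {π : ℕ → ProbabilityMeasure (PathSpace T d)}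
    (hπ : ∀ n, π n ∈ transportPlans (ν n)) :
    IsTightMeasureSet (Set.range fun n => (π n : Measure (PathSpace T d))) := by
  have hm := tendsto_finsetSum Finset.univ fun t _ => tendsto_finsetSum Finset.univ fun i _ =>
    tendsto_integral_abs_of_wasserstein (fun n => hν n t i) (hμ t i)
      (tendsto_wasserstein_of_discrepancy hr t i)
  obtain ⟨C, hC⟩ := hm.bddAbove_range
  exact isTightMeasureSet_of_transportPlans hπ fun n => hC ⟨n, rfl⟩

variable {c : PathSpace T d → ℝ} {L : NNReal} (hc : LipschitzWith L c) {ε : ℕ → ℝ}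
  (hε : Tendsto ε atTop (𝓝 0)) (hrε : ∀ n, discrepancy (ν n) μ ≤ ε n)
  {π : ℕ → ProbabilityMeasure (PathSpace T d)}
  (hπ : ∀ n, IsMaximizer c (relaxedPlans (ε n) (ν n)) (π n))

include hc hε hrε hπ

/-- Limits of maximizers of the relaxed problems are maximizers of the limiting problem. -/
lemma isMaximizer_of_tendsto {F : Ultrafilter ℕ} (hF : (F : Filter ℕ) ≤ atTop)
    {ρ : ProbabilityMeasure (PathSpace T d)} (hρ : Tendsto π F (𝓝 ρ)) :
    IsMaximizer c (martingalePlans μ) ρ ∧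
      Tendsto (fun n => ∫ x, c x ∂(π n : Measure (PathSpace T d))) F
        (𝓝 (∫ x, c x ∂(ρ : Measure (PathSpace T d)))) := by
  have hW := tendsto_wasserstein_of_discrepancy hr
  have hw : ∀ t i, Tendsto (fun n => ν n t i) F (𝓝 (μ t i)) := fun t i =>
    (tendsto_of_wasserstein (fun n => hν n t i) (hμ t i) (hW t i)).mono_left hF
  have hm : ∀ t i, Tendsto (fun n => ∫ y, |y| ∂(ν n t i : Measure ℝ)) F
      (𝓝 (∫ y, |y| ∂(μ t i : Measure ℝ))) := fun t i =>
    (tendsto_integral_abs_of_wasserstein (fun n => hν n t i) (hμ t i) (hW t i)).mono_left hF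
  have hmem := mem_relaxedPlans_of_tendsto hμ hw hm (hε.mono_left hF) (fun n => (hπ n).1) hρ
  have hlim := tendsto_integral_of_lipschitz hm (fun n => (hπ n).1.1) hmem.1 hρ hc
  rw [← martingalePlans_eq_relaxedPlans_zero] at hmem
  refine ⟨isMaximizer_iff.2 ⟨hmem, fun η hη => ?_⟩, hlim⟩
  -- The competitor `η` need not be feasible for the relaxed problems; its approximants `η' n` are,
  -- because `discrepancy (ν n) μ ≤ ε n`.
  choose η' hη' hη'c using fun n => exists_relaxedPlan hη hμ (hν n)
  have hsum : Tendsto (fun n => ∫ x, c x ∂(π n : Measure (PathSpace T d)) +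
      L * ∑ t, ∑ i, (wasserstein (ν n t i) (μ t i)).toReal) F
      (𝓝 (∫ x, c x ∂(ρ : Measure (PathSpace T d)))) := by
    simpa using hlim.add (((tendsto_finsetSum _ fun t _ => tendsto_finsetSum _ fun i _ =>
      hW t i).const_mul (L : ℝ)).mono_left hF)
  refine ge_of_tendsto' hsum fun n => ?_
  have h1 := neg_le_of_abs_le (hη'c n c L hc)
  have h2 := (isMaximizer_iff.1 (hπ n)).2 (η' n) (relaxedPlans_mono (hrε n) (hη' n))
  linarith

lemma exists_limit_isMaximizer {F : Ultrafilter ℕ} (hF : (F : Filter ℕ) ≤ atTop) :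
    ∃ ρ, Tendsto π F (𝓝 ρ) ∧ IsMaximizer c (martingalePlans μ) ρ ∧
      Tendsto (fun n => ∫ x, c x ∂(π n : Measure (PathSpace T d))) F
        (𝓝 (∫ x, c x ∂(ρ : Measure (PathSpace T d)))) := by
  obtain ⟨ρ, hρ⟩ := exists_tendsto_ultrafilter
    (isTightMeasureSet_of_discrepancy hμ hν hr fun n => (hπ n).1.1) F
  exact ⟨ρ, hρ, isMaximizer_of_tendsto hμ hν hr hc hε hrε hπ hF hρ⟩

/-- Along every ultrafilter the maximizers have a limit attaining the limiting value, which does not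
depend on the ultrafilter. -/
lemma tendsto_upperValue : Tendsto (fun n => upperValue c (relaxedPlans (ε n) (ν n))) atTop
    (𝓝 (upperValue c (martingalePlans μ))) := by
  refine (tendsto_iff_ultrafilter _ _ _).2 fun F hF => ?_
  obtain ⟨ρ, -, hρ, hlim⟩ := exists_limit_isMaximizer hμ hν hr hc hε hrε hπ hF
  rw [← hρ.2, ← funext fun n => (hπ n).2]
  exact (continuous_coe_real_ereal.tendsto _).comp hlim

lemma tendsto_of_unique_isMaximizer {ρ : ProbabilityMeasure (PathSpace T d)}
    (huniq : ∀ ρ', IsMaximizer c (martingalePlans μ) ρ' → ρ' = ρ) : Tendsto π atTop (𝓝 ρ) := by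
  refine (tendsto_iff_ultrafilter _ _ _).2 fun F hF => ?_
  obtain ⟨ρ', hρ', hmax, -⟩ := exists_limit_isMaximizer hμ hν hr hc hε hrε hπ hF
  exact huniq ρ' hmax ▸ hρ'

end Stability

/-- Stability of the maximization problems. -/
lemma stability_of_maximization {μ : Marginals T d} (hμ : μ.FiniteFirstMoments)
    (hM : (martingalePlans μ).Nonempty) {ν : ℕ → Marginals T d}
    (hν : ∀ n, (ν n).FiniteFirstMoments)
    (hr : Tendsto (fun n => discrepancy (ν n) μ) atTop (𝓝 0))
    {c : PathSpace T d → ℝ} {L : NNReal} (hc : LipschitzWith L c) {ε : ℕ → ℝ}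
    (hε : Tendsto ε atTop (𝓝 0)) (hrε : ∀ n, discrepancy (ν n) μ ≤ ε n) :
    Tendsto (fun n => upperValue c (relaxedPlans (ε n) (ν n))) atTop
        (𝓝 (upperValue c (martingalePlans μ))) ∧
      (upperValue c (martingalePlans μ) ≠ ⊤ ∧ upperValue c (martingalePlans μ) ≠ ⊥) ∧
      (∀ n, ∃ π, IsMaximizer c (relaxedPlans (ε n) (ν n)) π) ∧
      ∀ π : ℕ → ProbabilityMeasure (PathSpace T d),
        (∀ n, IsMaximizer c (relaxedPlans (ε n) (ν n)) (π n)) →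
          IsTightMeasureSet (Set.range fun n => (π n : Measure (PathSpace T d))) ∧
          (∀ ρ, MapClusterPt ρ atTop π → IsMaximizer c (martingalePlans μ) ρ) ∧
          (∀ ρ, IsMaximizer c (martingalePlans μ) ρ →
            (∀ ρ', IsMaximizer c (martingalePlans μ) ρ' → ρ' = ρ) → Tendsto π atTop (𝓝 ρ)) := by
  obtain ⟨η, hη⟩ := hM
  have hex : ∀ n, ∃ π, IsMaximizer c (relaxedPlans (ε n) (ν n)) π := fun n => by
    obtain ⟨η', hη', -⟩ := exists_relaxedPlan hη hμ (hν n)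
    exact exists_isMaximizer (hν n) ⟨η', relaxedPlans_mono (hrε n) hη'⟩ hc
  choose π₀ hπ₀ using hex
  -- A single limit point shows that the limiting value is attained, hence finite.
  obtain ⟨ρ₀, -, hρ₀, -⟩ := exists_limit_isMaximizer hμ hν hr hc hε hrε hπ₀
    Nat.hyperfilter_le_atTop
  refine ⟨tendsto_upperValue hμ hν hr hc hε hrε hπ₀, ?_, fun n => ⟨π₀ n, hπ₀ n⟩, fun π hπ =>
    ⟨isTightMeasureSet_of_discrepancy hμ hν hr fun n => (hπ n).1.1, fun ρ hρ => ?_,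
      fun ρ _ huniq => tendsto_of_unique_isMaximizer hμ hν hr hc hε hrε hπ huniq⟩⟩
  · rw [← hρ₀.2]
    exact ⟨EReal.coe_ne_top _, EReal.coe_ne_bot _⟩
  · obtain ⟨F, hF, hFρ⟩ := mapClusterPt_iff_ultrafilter.1 hρ
    exact (isMaximizer_of_tendsto hμ hν hr hc hε hrε hπ hF hFρ).1

end Optimization

end MMOT

theorem theorem3p1 {T d : ℕ} (μ : MMOT.Marginals T d) (hμ : μ.FiniteFirstMoments)
    (hM : (MMOT.martingalePlans μ).Nonempty)
    (μn : ℕ → MMOT.Marginals T d) (hμn : ∀ n, (μn n).FiniteFirstMoments)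
    (hr : Tendsto (fun n => MMOT.discrepancy (μn n) μ) atTop (𝓝 0)) :
    (∀ n, (MMOT.relaxedPlans (MMOT.discrepancy (μn n) μ) (μn n)).Nonempty) ∧
    ∀ c : MMOT.PathSpace T d → ℝ, (∃ L, LipschitzWith L c) →
      ∀ ε : ℕ → ℝ, Tendsto ε atTop (𝓝 0) → (∀ n, MMOT.discrepancy (μn n) μ ≤ ε n) →
        -- (i) convergence of the values, which are finite in the limit
        (Tendsto (fun n => MMOT.upperValue c (MMOT.relaxedPlans (ε n) (μn n))) atTop
            (𝓝 (MMOT.upperValue c (MMOT.martingalePlans μ))) ∧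
          Tendsto (fun n => MMOT.lowerValue c (MMOT.relaxedPlans (ε n) (μn n))) atTop
            (𝓝 (MMOT.lowerValue c (MMOT.martingalePlans μ))) ∧
          (MMOT.upperValue c (MMOT.martingalePlans μ) ≠ ⊤ ∧
            MMOT.upperValue c (MMOT.martingalePlans μ) ≠ ⊥) ∧
          (MMOT.lowerValue c (MMOT.martingalePlans μ) ≠ ⊤ ∧
            MMOT.lowerValue c (MMOT.martingalePlans μ) ≠ ⊥)) ∧
        -- (ii) for the maximization problems
        ((∀ n, ∃ π, MMOT.IsMaximizer c (MMOT.relaxedPlans (ε n) (μn n)) π) ∧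
          ∀ π : ℕ → ProbabilityMeasure (MMOT.PathSpace T d),
            (∀ n, MMOT.IsMaximizer c (MMOT.relaxedPlans (ε n) (μn n)) (π n)) →
              IsTightMeasureSet
                (Set.range fun n => (π n : Measure (MMOT.PathSpace T d))) ∧
              (∀ ρ, MapClusterPt ρ atTop π →
                MMOT.IsMaximizer c (MMOT.martingalePlans μ) ρ) ∧
              (∀ ρ, MMOT.IsMaximizer c (MMOT.martingalePlans μ) ρ →
                (∀ ρ', MMOT.IsMaximizer c (MMOT.martingalePlans μ) ρ' → ρ' = ρ) →
                Tendsto π atTop (𝓝 ρ))) ∧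
        -- (ii) for the minimization problems
        ((∀ n, ∃ π, MMOT.IsMinimizer c (MMOT.relaxedPlans (ε n) (μn n)) π) ∧
          ∀ π : ℕ → ProbabilityMeasure (MMOT.PathSpace T d),
            (∀ n, MMOT.IsMinimizer c (MMOT.relaxedPlans (ε n) (μn n)) (π n)) →
              IsTightMeasureSet
                (Set.range fun n => (π n : Measure (MMOT.PathSpace T d))) ∧
              (∀ ρ, MapClusterPt ρ atTop π →
                MMOT.IsMinimizer c (MMOT.martingalePlans μ) ρ) ∧
              (∀ ρ, MMOT.IsMinimizer c (MMOT.martingalePlans μ) ρ →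
                (∀ ρ', MMOT.IsMinimizer c (MMOT.martingalePlans μ) ρ' → ρ' = ρ) →
                Tendsto π atTop (𝓝 ρ))) := by
  refine ⟨fun n => ?_, fun c ⟨L, hc⟩ ε hε hrε => ?_⟩
  · obtain ⟨η, hη⟩ := hM
    obtain ⟨η', hη', -⟩ := MMOT.exists_relaxedPlan hη hμ (hμn n)
    exact ⟨η', hη'⟩
  · obtain ⟨hv, hfin, hmax⟩ := MMOT.stability_of_maximization hμ hM hμn hr hc hε hrε
    -- Minimizing `c` is maximizing `-c`, which has the same Lipschitz constant.
    obtain ⟨hv', hfin', hmin⟩ := MMOT.stability_of_maximization hμ hM hμn hr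
      (c := fun x => -c x) (L := L) hc.neg hε hrε
    simp only [MMOT.lowerValue_eq_neg_upperValue, MMOT.isMinimizer_iff_isMaximizer_neg]
    refine ⟨⟨hv, (continuous_neg.tendsto _).comp hv', hfin, ?_, ?_⟩, hmax, hmin⟩
    · rw [Ne, EReal.neg_eq_top_iff]
      exact hfin'.2
    · rw [Ne, EReal.neg_eq_bot_iff]
      exact hfin'.1
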